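/- Let $m\ge 1$, $n=2m$ and $0\le i\le m-1$, and let $$F(x)=x^{2^m+1}+x^{2^i+1},\qquad F:\mathbb F_{2^n}\to\mathbb F_{2^n}.$$ For $a\in\mathbb F_{2^n}\setminus\{0\}$ let $F_a(x)=\mathrm{Tr}(aF(x))$ be the component function of $F$ at $a$, where $\mathrm{Tr}$ is the trace from $\mathbb F_{2^n}$ to $\mathbb F_2$. The component $F_a$ is called bent if $$\sum_{x\in\mathbb F_{2^n}}(-1)^{F_a(x)+\mathrm{Tr}(\omega x)}=\pm 2^{n/2}\quad\text{for every }\omega\in\mathbb F_{2^n}.$$ Then $F$ has exactly $2^n-2^m$ bent components if and only if $i=0$. Moreover, $i=0$ if and only if $F$ is (extended) affine equivalent to $x^{2^m+1}$, that is, if and only if there are $\mathbb F_2$-affine permutations $A,B$ of $\mathbb F_{2^n}$ and an $\mathbb F_2$-affine map $C:\mathbb F_{2^n}\to\mathbb F_{2^n}$ such that $F(x)=A\big(B(x)^{2^m+1}\big)+C(x)$ for all $x\in\mathbb F_{2^n}$. -/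

import Mathlib

namespace BentFunctions

/-- The inner product `⟨w, x⟩ = Tr(w x)` on a finite field `K` of characteristic two, where `Tr` is
the absolute trace from `K` to the field with two elements. -/
noncomputable def pairing {K : Type*} [Field K] [Algebra (ZMod 2) K] (w x : K) : ZMod 2 :=
  Algebra.trace (ZMod 2) K (w * x)

/-- The Walsh transform `W_f(w) = ∑_v (-1)^(f(v) + ⟨w, v⟩)` of a Boolean function `f` on `K`. -/
noncomputable def walsh {K : Type*} [Field K] [Fintype K] [Algebra (ZMod 2) K]
    (f : K → ZMod 2) (w : K) : ℤ :=
  ∑ v : K, (-1 : ℤ) ^ (f v + pairing w v).val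

/-- `f` is bent if `W_f(w) = ± 2^(n/2)` for all `w`, where `n` is the dimension of `K` over the
field with two elements. -/
def IsBent {K : Type*} [Field K] [Fintype K] [Algebra (ZMod 2) K] (f : K → ZMod 2) : Prop :=
  ∀ w : K,
    (walsh f w : ℝ) = (2 : ℝ) ^ ((Module.finrank (ZMod 2) K : ℝ) / 2) ∨
    (walsh f w : ℝ) = -(2 : ℝ) ^ ((Module.finrank (ZMod 2) K : ℝ) / 2)

/-- The component function `F_a(x) = ⟨a, F(x)⟩` of a vectorial function `F`. -/
noncomputable def component {K : Type*} [Field K] [Algebra (ZMod 2) K]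
    (F : K → K) (a : K) : K → ZMod 2 :=
  fun x => pairing a (F x)

/-- The number of bent components of `F`: the number of nonzero `a` such that `F_a` is bent. -/
noncomputable def numBentComponents {K : Type*} [Field K] [Fintype K] [Algebra (ZMod 2) K]
    (F : K → K) : ℕ :=
  {a : K | a ≠ 0 ∧ IsBent (component F a)}.ncard

/-- (Extended) affine equivalence of vectorial functions: `F = A ∘ G ∘ B + C` with affine
permutations `A`, `B` and an affine map `C`, all over the field with two elements. -/
def AffineEquivalent {K : Type*} [Field K] [Algebra (ZMod 2) K] (F G : K → K) : Prop :=
  ∃ (A B : K ≃ᵃ[ZMod 2] K) (C : K →ᵃ[ZMod 2] K), ∀ x : K, F x = A (G (B x)) + C x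

/-- The binomial `x ^ (2^m + 1) + x ^ (2^i + 1)`. -/
def binomial {K : Type*} [Field K] (m i : ℕ) : K → K :=
  fun x => x ^ (2 ^ m + 1) + x ^ (2 ^ i + 1)

end BentFunctions

/-!
For `a ≠ 0` the component `x ↦ ⟨a, F x⟩` of a function `F` whose polarization
`F (x + y) + F x + F y + F 0` is biadditive is a quadratic function, and it is bent exactly when the
radical of its polarization is zero (`isBent_iff_of_quadratic`). Let `N` be the set of all `a` that
are zero or whose component is not bent. The number of bent components is `2 ^ (2 * m) - |N|`.
Write `L` for the subfield with `2 ^ m` elements.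

For `i = 0` the polarization of the binomial is that of `x ^ (2 ^ m + 1)`, and the component at `a`
has the radical `{x | (a + a ^ 2 ^ m) * x ^ 2 ^ m = 0}`; so `N = L`. The binomial is then
`x ^ (2 ^ m + 1)` plus the additive map `x ^ 2`. Conversely, the number of bent components cannot
drop when passing to an affine equivalent function (`AffineEquivalent.ncard_nonbentSet_le`), and
`|N| ≥ 2 ^ m` always (`two_pow_le_ncard_nonbentSet`). So the theorem comes down to `|N| ≠ 2 ^ m`
for `0 < i < m`.

Two general facts about an arbitrary `F` are used. By divisibility of sums of Walsh coefficients,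
every subspace of dimension exceeding `m` contains a nonzero element of `N`
(`exists_mem_nonbentSet_of_lt_finrank`). By a Bose–Burton argument, `N` therefore meets every
subspace `H` in at least `|H| / 2 ^ m` elements, and a Fourier argument shows that `N` is a
subspace as soon as `|N| = 2 ^ m` (`mem_nonbentSet_of_forall_orthogonal`).

Let `0 < i < m` and suppose `|N| = 2 ^ m`. Every nonzero `x` lies in the radical of some nonzero
component; were all of these indexed by `L`, then `2 ^ m + 1` would divide `2 ^ (2 * i) - 1`, which
is impossible (`exists_mem_nonbentSet_binomial_pow_ne`). So `N` is not contained in `L`. On the other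
hand, `N` contains the powers `b ^ (2 ^ i + 1)` with `b ∈ L`, and these span `L` unless
`m = 2 * i`; then `L ⊆ N`, and `L = N` by cardinality. If `m = 2 * i`, put `q = 2 ^ i`; then `N` is a
plane over the field with `q` elements, stable under the unipotent map `x ↦ x ^ q`, and this again
gives `N ⊆ L` (`pow_eq_self_of_mem_nonbentSet`).
-/

namespace BentFunctions

/-! ### Signs and sums of signs of linear forms -/

/-- The sign `(-1)^z` of an element of the field with two elements, as an integer. -/
def sgn (z : ZMod 2) : ℤ := (-1) ^ z.val

@[simp] lemma sgn_zero : sgn 0 = 1 := rfl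

lemma sgn_add : ∀ a b : ZMod 2, sgn (a + b) = sgn a * sgn b := by decide

lemma sgn_mul_self : ∀ a : ZMod 2, sgn a * sgn a = 1 := by decide

lemma sgn_eq_neg_one : ∀ a : ZMod 2, a ≠ 0 → sgn a = -1 := by decide

lemma sgn_le_one : ∀ a : ZMod 2, sgn a ≤ 1 := by decide

lemma eq_zero_of_sgn_eq_one : ∀ a : ZMod 2, sgn a = 1 → a = 0 := by decide

/-- Orthogonality: the signs of a nonzero additive form cancel. -/
lemma sum_sgn_eq_zero {V : Type*} [AddCommGroup V] [Fintype V] (φ : V → ZMod 2)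
    (hφ : ∀ a b, φ (a + b) = φ a + φ b) {v : V} (hv : φ v ≠ 0) : ∑ x, sgn (φ x) = 0 := by
  have h : ∑ x, sgn (φ x) = ∑ x, sgn (φ (x + v)) :=
    (Fintype.sum_equiv (Equiv.addRight v) _ _ (fun x => rfl)).symm
  simp only [hφ, sgn_add, sgn_eq_neg_one _ hv, mul_neg, mul_one, Finset.sum_neg_distrib] at h
  linarith

lemma sum_sgn_eq_card {V : Type*} [Fintype V] (φ : V → ZMod 2) (hφ : ∀ v, φ v = 0) :
    ∑ x, sgn (φ x) = Fintype.card V := by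
  simp [hφ]

section Field

variable {K : Type*} [Field K] [Algebra (ZMod 2) K]

lemma pairing_comm (a b : K) : pairing a b = pairing b a := by
  simp [pairing, mul_comm]

lemma pairing_add (a b c : K) : pairing a (b + c) = pairing a b + pairing a c := by
  simp [pairing, mul_add]

lemma add_pairing (a b c : K) : pairing (a + b) c = pairing a c + pairing b c := by
  simp [pairing, add_mul]

@[simp] lemma pairing_zero (a : K) : pairing a 0 = 0 := by simp [pairing]

@[simp] lemma zero_pairing (a : K) : pairing 0 a = 0 := by simp [pairing]

/-- The linear form `⟨a, ·⟩`. -/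
noncomputable def pairingHom (a : K) : K →ₗ[ZMod 2] ZMod 2 where
  toFun := pairing a
  map_add' := pairing_add a
  map_smul' c x := by simp [pairing]

@[simp] lemma pairingHom_apply (a x : K) : pairingHom a x = pairing a x := rfl

variable [Fintype K]

lemma exists_pairing_ne_zero {a : K} (ha : a ≠ 0) : ∃ b, pairing a b ≠ 0 := by
  by_contra! h
  exact ha ((traceForm_nondegenerate (ZMod 2) K).1 a (fun b => by simpa [pairing] using h b))

/-- Every linear form on `K` is `⟨a, ·⟩` for some `a`. -/
lemma exists_pairing_eq (φ : K →ₗ[ZMod 2] ZMod 2) : ∃ a, ∀ x, φ x = pairing a x := by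
  refine ⟨((Algebra.traceForm (ZMod 2) K).toDual (traceForm_nondegenerate _ _)).symm φ,
    fun x => ?_⟩
  exact (LinearMap.BilinForm.apply_toDual_symm_apply
    (hB := traceForm_nondegenerate (ZMod 2) K) φ x).symm

lemma sum_sgn_pairing_of_ne {w : K} (hw : w ≠ 0) : ∑ x, sgn (pairing w x) = 0 := by
  obtain ⟨b, hb⟩ := exists_pairing_ne_zero hw
  exact sum_sgn_eq_zero (pairing w) (pairing_add w) hb

lemma walsh_eq (f : K → ZMod 2) (w : K) : walsh f w = ∑ v, sgn (f v + pairing w v) := rfl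

lemma card_eq_two_pow_finrank : Fintype.card K = 2 ^ Module.finrank (ZMod 2) K := by
  rw [Module.card_eq_pow_finrank (K := ZMod 2), ZMod.card]

lemma isBent_iff_sq (f : K → ZMod 2) :
    IsBent f ↔ ∀ w, walsh f w ^ 2 = (Fintype.card K : ℤ) := by
  refine forall_congr' fun w => ?_
  rw [← sq_eq_sq_iff_eq_or_eq_neg, ← Real.rpow_natCast, ← Real.rpow_natCast,
    ← Real.rpow_mul (by norm_num), card_eq_two_pow_finrank]
  push_cast
  rw [div_mul_cancel₀ _ (by norm_num : (2 : ℝ) ≠ 0), Real.rpow_natCast]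
  constructor
  · intro h
    rw [← Nat.cast_two (R := ℝ), Real.rpow_natCast] at h
    exact_mod_cast h
  · intro h
    rw [← Nat.cast_two (R := ℝ), Real.rpow_natCast]
    exact_mod_cast h

/-! ### Bentness of quadratic functions -/

lemma zmod_two_add_self : ∀ a : ZMod 2, a + a = 0 := by decide

instance charP_two : CharP K 2 := charP_of_injective_algebraMap
  (algebraMap (ZMod 2) K).injective 2

/-- The polarization of a function in characteristic two. -/
def polarization {V W : Type*} [Add V] [Zero V] [Add W] (f : V → W) (x y : V) : W :=
  f (x + y) + f x + f y + f 0

/-- The square of a Walsh coefficient of a quadratic function is a sum over its radical. -/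
lemma walsh_sq (f : K → ZMod 2)
    (hf : ∀ x y z, polarization f x (y + z) = polarization f x y + polarization f x z)
    (w : K) [DecidablePred fun y => ∀ u, polarization f y u = 0] :
    walsh f w ^ 2 = (Fintype.card K : ℤ) *
      ∑ y with (∀ u, polarization f y u = 0), sgn (f y + f 0 + pairing w y) := by
  have key : walsh f w ^ 2 =
      ∑ y, sgn (f y + f 0 + pairing w y) * ∑ u, sgn (polarization f y u) := by
    rw [sq, walsh_eq, Finset.sum_mul_sum]
    -- substitute `v = y + u` in the inner sum
    have h1 : ∀ u : K, ∑ v, sgn (f u + pairing w u) * sgn (f v + pairing w v) =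
        ∑ y, sgn (f u + pairing w u) * sgn (f (y + u) + pairing w (y + u)) := fun u =>
      (Fintype.sum_equiv (Equiv.addRight u) _ _ (fun x => rfl)).symm
    simp_rw [h1]
    rw [Finset.sum_comm]
    refine Finset.sum_congr rfl fun y _ => ?_
    rw [Finset.mul_sum]
    refine Finset.sum_congr rfl fun u _ => ?_
    rw [← sgn_add, ← sgn_add, pairing_add, polarization]
    congr 1
    generalize f u = a; generalize pairing w u = b; generalize f (y + u) = c
    generalize pairing w y = d; generalize f y = e; generalize f 0 = g
    revert a b c d e g
    decide
  rw [key, Finset.mul_sum, Finset.sum_filter]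
  refine Finset.sum_congr rfl fun y _ => ?_
  split_ifs with hy
  · rw [sum_sgn_eq_card _ hy, mul_comm]
  · push Not at hy
    obtain ⟨u, hu⟩ := hy
    rw [sum_sgn_eq_zero _ (hf y) hu, mul_zero]

/-- A quadratic function is bent exactly when its polarization has trivial radical. -/
theorem isBent_iff_of_quadratic (f : K → ZMod 2)
    (hf : ∀ x y z, polarization f x (y + z) = polarization f x y + polarization f x z) :
    IsBent f ↔ ∀ y, y ≠ 0 → ∃ u, polarization f y u ≠ 0 := by
  classical
  have hcard : (Fintype.card K : ℤ) ≠ 0 := by exact_mod_cast Fintype.card_ne_zero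
  have hsymm : ∀ x y, polarization f x y = polarization f y x := fun x y => by
    simp only [polarization, add_comm x y]; ring
  have hzero : ∀ y, polarization f y 0 = 0 := fun y => by
    have := hf y 0 0
    simpa using this
  rw [isBent_iff_sq]
  constructor
  · intro h y hy
    by_contra! hrad
    -- on the radical, `f + f 0` is additive, so its signs cancel or add up to at least two
    let R : AddSubgroup K :=
      { carrier := {x | ∀ u, polarization f x u = 0}
        zero_mem' := fun u => by rw [hsymm, hzero]
        add_mem' := fun {a b} ha hb u => by
          rw [hsymm, hf, hsymm u a, hsymm u b, ha u, hb u, add_zero]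
        neg_mem' := fun {a} ha => by rwa [CharTwo.neg_eq] }
    have hadd : ∀ a b : R, f (a + b : R) + f 0 = (f a + f 0) + (f b + f 0) := by
      intro a b
      have := a.2 b
      simp only [polarization] at this
      push_cast
      revert this
      generalize f (a + b : K) = p; generalize f a = q; generalize f b = r; generalize f 0 = s
      revert p q r s
      decide
    have hsum : ∑ y with (∀ u, polarization f y u = 0), sgn (f y + f 0 + pairing 0 y) =
        ∑ x : R, sgn (f x + f 0) := by
      simp only [zero_pairing, add_zero]
      exact Finset.sum_subtype _ (fun x => by simp [R]) (fun x => sgn (f x + f 0))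
    have h0 := h 0
    rw [walsh_sq f hf, hsum] at h0
    have h1 : ∑ x : R, sgn (f x + f 0) = 1 := by
      have := mul_left_cancel₀ hcard (h0.trans (mul_one _).symm)
      exact this
    by_cases hφ : ∃ v : R, f v + f 0 ≠ 0
    · obtain ⟨v, hv⟩ := hφ
      rw [sum_sgn_eq_zero (fun x : R => f x + f 0) hadd hv] at h1
      exact zero_ne_one h1
    · push Not at hφ
      rw [sum_sgn_eq_card _ hφ] at h1
      have : Fintype.card R = 1 := by exact_mod_cast h1
      rw [Fintype.card_eq_one_iff] at this
      obtain ⟨r, hr⟩ := this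
      have e := (hr ⟨y, hrad⟩).trans (hr 0).symm
      exact hy (congrArg Subtype.val e)
  · intro h w
    have : (Finset.univ.filter fun y => ∀ u, polarization f y u = 0) = {0} := by
      ext y
      simp only [Finset.mem_filter, Finset.mem_univ, true_and, Finset.mem_singleton]
      constructor
      · intro hy
        by_contra hne
        obtain ⟨u, hu⟩ := h y hne
        exact hu (hy u)
      · rintro rfl u
        rw [hsymm, hzero]
    rw [walsh_sq f hf, this, Finset.sum_singleton, pairing_zero, zmod_two_add_self]
    simp

end Field

/-! ### The set of nonbent components -/

section Field

variable {K : Type*} [Field K] [Algebra (ZMod 2) K] [Fintype K]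

/-- The index set of the components that are not bent, together with the zero component. It is
the complement of the set counted by `numBentComponents`. -/
def nonbentSet (F : K → K) : Set K := {a | a = 0 ∨ ¬ IsBent (component F a)}

lemma zero_mem_nonbentSet (F : K → K) : (0 : K) ∈ nonbentSet F := Or.inl rfl

lemma numBentComponents_add_ncard (F : K → K) :
    numBentComponents F + (nonbentSet F).ncard = Fintype.card K := by
  have : {a : K | a ≠ 0 ∧ IsBent (component F a)} = (nonbentSet F)ᶜ := by
    ext a
    simp [nonbentSet]
  rw [numBentComponents, this, add_comm, Set.ncard_add_ncard_compl, Nat.card_eq_fintype_card]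

/-- All components indexed by the nonzero elements of a subspace can be bent only if the subspace
has dimension at most `m`: otherwise the sum of the Walsh coefficients at zero over the subspace
would be both divisible by `2 ^ (m + 1)` and an odd multiple of `2 ^ m`. -/
theorem exists_mem_nonbentSet_of_lt_finrank (F : K → K) {m : ℕ}
    (hK : Fintype.card K = 2 ^ (2 * m)) (hm : 0 < m) (W : Submodule (ZMod 2) K)
    (hW : m < Module.finrank (ZMod 2) W) : ∃ a ∈ W, a ≠ 0 ∧ a ∈ nonbentSet F := by
  classical
  by_contra! hcon
  have hbent : ∀ a ∈ W, a ≠ 0 → IsBent (component F a) := fun a ha h0 => by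
    by_contra hb
    exact hcon a ha h0 (Or.inr hb)
  have hWcard : (2 : ℤ) ^ (m + 1) ∣ (Fintype.card W : ℤ) := by
    rw [Module.card_eq_pow_finrank (K := ZMod 2), ZMod.card]
    push_cast
    exact pow_dvd_pow _ hW
  have hS : (2 : ℤ) ^ (m + 1) ∣ ∑ a : W, walsh (component F (a : K)) 0 := by
    simp_rw [walsh_eq, zero_pairing, add_zero, component]
    rw [Finset.sum_comm]
    refine Finset.dvd_sum fun x _ => ?_
    by_cases hx : ∀ a : W, pairing (a : K) (F x) = 0
    · rw [sum_sgn_eq_card _ hx]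
      exact hWcard
    · push Not at hx
      obtain ⟨a, ha⟩ := hx
      rw [sum_sgn_eq_zero (fun a : W => pairing (a : K) (F x))
        (fun a b => add_pairing (a : K) b _) ha]
      exact dvd_zero _
  have hterm : ∀ a : W, (2 : ℤ) ^ (m + 1) ∣
      walsh (component F (a : K)) 0 - (2 ^ m - if a = 0 then 2 ^ m else 0) := by
    intro a
    split_ifs with ha
    · subst ha
      have : walsh (component F ((0 : W) : K)) 0 = (2 : ℤ) ^ (2 * m) := by
        simp [walsh_eq, component, hK]
      rw [this, sub_self, sub_zero]
      exact pow_dvd_pow _ (by omega)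
    · have h2 := (isBent_iff_sq _).1 (hbent a a.2 (by simpa using ha)) 0
      rw [hK, mul_comm, pow_mul] at h2
      push_cast at h2
      rcases sq_eq_sq_iff_eq_or_eq_neg.1 h2 with h | h <;> rw [h]
      · simp
      · exact ⟨-1, by ring⟩
  have hsum := Finset.dvd_sum (s := Finset.univ) (fun a _ => hterm a)
  rw [Finset.sum_sub_distrib, Finset.sum_sub_distrib] at hsum
  simp only [Finset.sum_const, Finset.card_univ, nsmul_eq_mul, Finset.sum_ite_eq',
    Finset.mem_univ, if_true] at hsum
  have h1 := (dvd_sub_right hS).1 hsum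
  have h2 := (dvd_sub_right (hWcard.mul_right ((2 : ℤ) ^ m))).1 h1
  have h3 : (2 : ℕ) ^ (m + 1) ∣ 2 ^ m := by exact_mod_cast h2
  have h4 : 2 ^ m < 2 ^ (m + 1) := Nat.pow_lt_pow_right (by norm_num) (Nat.lt_succ_self m)
  exact absurd (Nat.le_of_dvd (by positivity) h3) (Nat.not_le_of_lt h4)

/-- The Bose–Burton bound: if every subspace of dimension exceeding `m` contains a nonzero element
of `N`, then `N` meets every subspace `H` in at least `|H| / 2 ^ m` elements. A maximal subspace of
`H` avoiding `N` has dimension at most `m`, and its translates by `N ∩ H` cover `H`. -/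
theorem card_le_ncard_inter_mul {V : Type*} [AddCommGroup V] [Module (ZMod 2) V] [Finite V]
    {N : Set V} {m : ℕ} (h0 : (0 : V) ∈ N)
    (hN : ∀ W : Submodule (ZMod 2) V, m < Module.finrank (ZMod 2) W → ∃ a ∈ W, a ≠ 0 ∧ a ∈ N)
    (H : Submodule (ZMod 2) V) :
    Nat.card H ≤ (N ∩ H).ncard * 2 ^ m := by
  classical
  have := Fintype.ofFinite V
  obtain ⟨W, hWmax⟩ := Set.Finite.exists_maximal
    (s := {W : Submodule (ZMod 2) V | W ≤ H ∧ ∀ a ∈ W, a ∈ N → a = 0}) (Set.toFinite _)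
    ⟨⊥, bot_le, fun a ha _ => (Submodule.mem_bot _).1 ha⟩
  obtain ⟨⟨hWH, hWN⟩, hmax⟩ := hWmax
  have hWm : Module.finrank (ZMod 2) W ≤ m := by
    by_contra! hlt
    obtain ⟨a, ha, hane, haN⟩ := hN W hlt
    exact hane (hWN a ha haN)
  have hWcard : Nat.card W ≤ 2 ^ m := by
    rw [Nat.card_eq_fintype_card, Module.card_eq_pow_finrank (K := ZMod 2), ZMod.card]
    exact Nat.pow_le_pow_right (by norm_num) hWm
  have hcover : ∀ h ∈ H, ∃ a ∈ N ∩ H, ∃ w ∈ W, a + w = h := by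
    intro h hh
    by_cases hw : h ∈ W
    · exact ⟨0, ⟨h0, H.zero_mem⟩, h, hw, zero_add h⟩
    · have hnot : ¬ (∀ a ∈ W ⊔ Submodule.span (ZMod 2) {h}, a ∈ N → a = 0) := by
        intro hall
        have hle := hmax ⟨sup_le hWH ((Submodule.span_singleton_le_iff_mem _ _).2 hh), hall⟩
          le_sup_left
        exact hw (hle (Submodule.mem_sup_right (Submodule.mem_span_singleton_self h)))
      push Not at hnot
      obtain ⟨a, ha, haN, hane⟩ := hnot
      obtain ⟨w, hwW, z, hz, rfl⟩ := Submodule.mem_sup.1 ha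
      obtain ⟨c, rfl⟩ := Submodule.mem_span_singleton.1 hz
      have hc : c = 0 ∨ c = 1 := (by decide : ∀ c : ZMod 2, c = 0 ∨ c = 1) c
      rcases hc with rfl | rfl
      · rw [zero_smul, add_zero] at haN hane
        exact absurd (hWN w hwW haN) hane
      · rw [one_smul] at haN
        exact ⟨w + h, ⟨haN, H.add_mem (hWH hwW) hh⟩, -w, W.neg_mem hwW, by abel⟩
  have hsurj : Function.Surjective (fun p : (N ∩ H : Set V) × W =>
      if hp : (p.1 : V) + p.2 ∈ H then (⟨_, hp⟩ : H) else 0) := by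
    rintro ⟨h, hh⟩
    obtain ⟨a, ha, w, hw, rfl⟩ := hcover h hh
    exact ⟨(⟨a, ha⟩, ⟨w, hw⟩), by simp [hh]⟩
  calc Nat.card H ≤ Nat.card ((N ∩ H : Set V) × W) := Nat.card_le_card_of_surjective _ hsurj
    _ = (N ∩ H).ncard * Nat.card W := by rw [Nat.card_prod]; rfl
    _ ≤ _ := Nat.mul_le_mul_left _ hWcard

lemma card_le_two_mul_card_ker {V : Type*} [AddCommGroup V] [Module (ZMod 2) V] [Finite V]
    (φ : V →ₗ[ZMod 2] ZMod 2) : Nat.card V ≤ Nat.card φ.ker * 2 := by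
  rw [Submodule.card_eq_card_quotient_mul_card φ.ker]
  refine Nat.mul_le_mul_left _ ?_
  rw [Nat.card_congr φ.quotKerEquivRange.toEquiv]
  calc Nat.card φ.range ≤ Nat.card (ZMod 2) := Nat.card_le_card_of_injective _ Subtype.val_injective
    _ = 2 := by simp

/-- If the number of bent components attains the maximum, then the set of nonbent components
contains its double orthogonal complement. Its sign sums `t_h = ∑ a ∈ N, (-1)^⟨h, a⟩` are
nonnegative and at most `|N|`, while `∑ t_h = |K|` and `∑ t_h ^ 2 = |K| |N|`; hence each of them is
`0` or `|N|`. -/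
theorem mem_nonbentSet_of_forall_orthogonal (F : K → K) {m : ℕ}
    (hK : Fintype.card K = 2 ^ (2 * m)) (hm : 0 < m) (hN : (nonbentSet F).ncard = 2 ^ m)
    {c : K} (hc : ∀ t : K, (∀ a ∈ nonbentSet F, pairing t a = 0) → pairing t c = 0) :
    c ∈ nonbentSet F := by
  classical
  set N : Finset K := (nonbentSet F).toFinset with hNdef
  have hNcard : (N.card : ℤ) = 2 ^ m := by
    rw [hNdef, ← Set.ncard_eq_toFinset_card', hN]; norm_num
  let t : K → ℤ := fun h => ∑ a ∈ N, sgn (pairing h a)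
  have ht_le : ∀ h, t h ≤ N.card := fun h => by
    have := Finset.sum_le_card_nsmul N (fun a => sgn (pairing h a)) 1 (fun a _ => sgn_le_one _)
    simpa using this
  have ht_nonneg : ∀ h, 0 ≤ t h := fun h => by
    have h1 := card_le_ncard_inter_mul (zero_mem_nonbentSet F)
      (exists_mem_nonbentSet_of_lt_finrank F hK hm) (pairingHom h).ker
    have h2 := card_le_two_mul_card_ker (pairingHom h)
    have hset : (nonbentSet F ∩ ((pairingHom h).ker : Set K)).ncard =
        (N.filter fun a => pairing h a = 0).card := by
      rw [← Set.ncard_coe_finset]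
      congr 1
      ext a
      simp [hNdef]
    rw [hset] at h1
    rw [Nat.card_eq_fintype_card, hK] at h2
    have h3 : 2 ^ m ≤ 2 * (N.filter fun a => pairing h a = 0).card := by
      have : 2 ^ m * 2 ^ m ≤ 2 * (N.filter fun a => pairing h a = 0).card * 2 ^ m := by
        rw [← pow_add, ← two_mul]
        nlinarith
      exact Nat.le_of_mul_le_mul_right this (by positivity)
    have h4 : t h = 2 * ((N.filter fun a => pairing h a = 0).card : ℤ) - N.card := by
      have hpt : ∀ a ∈ N, sgn (pairing h a) = 2 * (if pairing h a = 0 then 1 else 0) - 1 := by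
        intro a _
        generalize pairing h a = z
        revert z
        decide
      show ∑ a ∈ N, sgn (pairing h a) = _
      rw [Finset.sum_congr rfl hpt, Finset.sum_sub_distrib, ← Finset.mul_sum, Finset.sum_boole]
      simp
    rw [h4, hNcard]
    have : (2 : ℤ) ^ m ≤ 2 * ((N.filter fun a => pairing h a = 0).card : ℤ) := by exact_mod_cast h3
    linarith
  have hinv : ∀ d, ∑ h, t h * sgn (pairing h d) = if d ∈ N then (Fintype.card K : ℤ) else 0 := by
    intro d
    simp only [t, Finset.sum_mul]
    rw [Finset.sum_comm]
    have hpt : ∀ a ∈ N, ∑ h, sgn (pairing h a) * sgn (pairing h d) =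
        if d = a then (Fintype.card K : ℤ) else 0 := by
      intro a _
      simp_rw [← sgn_add, ← pairing_add, pairing_comm _ (a + d)]
      split_ifs with had
      · subst had
        simp [CharTwo.add_self_eq_zero]
      · exact sum_sgn_pairing_of_ne (fun h => had (CharTwo.add_eq_zero.1 h).symm)
    rw [Finset.sum_congr rfl hpt, Finset.sum_ite_eq]
  have h0N : (0 : K) ∈ N := by simp [hNdef, zero_mem_nonbentSet]
  have hsum : ∑ h, t h = Fintype.card K := by
    have := hinv 0
    simpa [h0N] using this
  have hsq : ∑ h, t h * t h = N.card * Fintype.card K := by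
    have h1 : ∀ h, t h * t h = ∑ d ∈ N, t h * sgn (pairing h d) := fun h => by
      rw [← Finset.mul_sum]
    simp_rw [h1]
    rw [Finset.sum_comm, Finset.sum_congr rfl (fun d _ => hinv d)]
    rw [Finset.sum_congr rfl (fun d hd => if_pos hd)]
    simp
  have hdich : ∀ h, t h * (N.card - t h) = 0 := by
    have hz : ∑ h, t h * (N.card - t h) = 0 := by
      simp_rw [mul_sub]
      rw [Finset.sum_sub_distrib, ← Finset.sum_mul, hsum, hsq]
      ring
    intro h
    exact (Finset.sum_eq_zero_iff_of_nonneg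
      (fun h _ => mul_nonneg (ht_nonneg h) (sub_nonneg.2 (ht_le h)))).1 hz h (Finset.mem_univ h)
  have hfix : ∀ h, t h * sgn (pairing h c) = t h := by
    intro h
    rcases mul_eq_zero.1 (hdich h) with h0 | h1
    · rw [h0, zero_mul]
    · have hall : ∀ a ∈ N, sgn (pairing h a) = 1 := by
        have hz : ∑ a ∈ N, (1 - sgn (pairing h a)) = 0 := by
          rw [Finset.sum_sub_distrib]
          simpa using h1
        intro a ha
        have := (Finset.sum_eq_zero_iff_of_nonneg
          (fun a _ => sub_nonneg.2 (sgn_le_one _))).1 hz a ha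
        linarith
      rw [hc h (fun a ha => eq_zero_of_sgn_eq_one _ (hall a (by simpa [hNdef] using ha))),
        sgn_zero, mul_one]
  have hfin := hinv c
  simp_rw [hfix, hsum] at hfin
  by_contra hcN
  rw [if_neg (by simpa [hNdef] using hcN)] at hfin
  exact absurd hfin (by exact_mod_cast Fintype.card_ne_zero)

lemma two_pow_le_ncard_nonbentSet (F : K → K) {m : ℕ} (hK : Fintype.card K = 2 ^ (2 * m))
    (hm : 0 < m) : 2 ^ m ≤ (nonbentSet F).ncard := by
  have h := card_le_ncard_inter_mul (zero_mem_nonbentSet F)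
    (exists_mem_nonbentSet_of_lt_finrank F hK hm) ⊤
  have htop : Nat.card (⊤ : Submodule (ZMod 2) K) = 2 ^ m * 2 ^ m := by
    rw [Nat.card_congr Submodule.topEquiv.toEquiv, Nat.card_eq_fintype_card, hK, two_mul, pow_add]
  rw [htop, Submodule.top_coe, Set.inter_univ] at h
  exact Nat.le_of_mul_le_mul_right h (by positivity)

end Field

/-! ### Fixed fields of powers of the Frobenius -/

section Field

variable {K : Type*} [Field K]

lemma pow_two_pow_two_pow (x : K) (j k : ℕ) : (x ^ 2 ^ j) ^ 2 ^ k = x ^ 2 ^ (j + k) := by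
  rw [← pow_mul, ← pow_add]

lemma setOf_pow_two_pow_eq {k : ℕ} (hk : 0 < k) :
    {x : K | x ^ 2 ^ k = x} = insert (0 : K) ↑(Polynomial.nthRootsFinset (2 ^ k - 1) (1 : K)) := by
  have h2 : 1 < 2 ^ k := Nat.one_lt_two_pow hk.ne'
  ext x
  rw [Set.mem_insert_iff, Finset.mem_coe, Polynomial.mem_nthRootsFinset (by omega),
    Set.mem_ofPred_eq]
  obtain ⟨d, hd⟩ : ∃ d, 2 ^ k = d + 1 := ⟨2 ^ k - 1, by omega⟩
  rw [hd, Nat.add_sub_cancel, pow_succ, mul_left_eq_self₀]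
  tauto

lemma ncard_setOf_pow_two_pow_eq_le {k : ℕ} (hk : 0 < k) :
    {x : K | x ^ 2 ^ k = x}.ncard ≤ 2 ^ k := by
  have h2 : 1 < 2 ^ k := Nat.one_lt_two_pow hk.ne'
  rw [setOf_pow_two_pow_eq hk]
  refine (Set.ncard_insert_le _ _).trans ?_
  rw [Set.ncard_coe_finset]
  have : (Polynomial.nthRootsFinset (2 ^ k - 1) (1 : K)).card ≤ 2 ^ k - 1 := by
    classical
    rw [Polynomial.nthRootsFinset_def]
    exact (Multiset.toFinset_card_le _).trans (Polynomial.card_nthRoots (2 ^ k - 1) (1 : K))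
  omega

variable [Fintype K]

lemma pow_two_pow_two_mul_add {m : ℕ} (hK : Fintype.card K = 2 ^ (2 * m)) (y : K) (k : ℕ) :
    y ^ 2 ^ (2 * m + k) = y ^ 2 ^ k := by
  rw [← pow_two_pow_two_pow, ← hK, FiniteField.pow_card]

lemma exists_isPrimitiveRoot {n d : ℕ} (hK : Fintype.card K = n + 1) (hd : d ∣ n) (hn : 0 < n) :
    ∃ ζ : K, IsPrimitiveRoot ζ d := by
  obtain ⟨g, hg⟩ := IsCyclic.exists_generator (α := Kˣ)
  have ho : orderOf g = n := by
    rw [orderOf_eq_card_of_forall_mem_zpowers hg, Nat.card_units, Nat.card_eq_fintype_card, hK]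
    rfl
  obtain ⟨e, rfl⟩ := hd
  refine ⟨(g ^ e : Kˣ), IsPrimitiveRoot.coe_units_iff.2 ?_⟩
  exact (ho ▸ IsPrimitiveRoot.orderOf g).pow hn (mul_comm d e)

lemma ncard_setOf_pow_two_pow_eq {n k : ℕ} (hK : Fintype.card K = 2 ^ n) (hn : 0 < n)
    (hk : 0 < k) (hkn : k ∣ n) : {x : K | x ^ 2 ^ k = x}.ncard = 2 ^ k := by
  have h2 : 1 < 2 ^ k := Nat.one_lt_two_pow hk.ne'
  have h3 : 1 < 2 ^ n := Nat.one_lt_two_pow hn.ne'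
  have hdvd : 2 ^ k - 1 ∣ 2 ^ n - 1 := by
    obtain ⟨e, rfl⟩ := hkn
    simpa [pow_mul] using Nat.sub_dvd_pow_sub_pow (2 ^ k) 1 e
  obtain ⟨ζ, hζ⟩ := exists_isPrimitiveRoot (K := K) (n := 2 ^ n - 1) (d := 2 ^ k - 1)
    (by omega) hdvd (by omega)
  rw [setOf_pow_two_pow_eq hk, Set.ncard_insert_of_notMem, Set.ncard_coe_finset,
    hζ.card_nthRootsFinset]
  · omega
  · rw [Finset.mem_coe, Polynomial.mem_nthRootsFinset (by omega), zero_pow (by omega)]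
    exact zero_ne_one

end Field

/-! ### The radicals of the components of the binomial -/

section Field

variable {K : Type*} [Field K] [Algebra (ZMod 2) K]

lemma add_pow_two_pow (x y : K) (k : ℕ) : (x + y) ^ 2 ^ k = x ^ 2 ^ k + y ^ 2 ^ k :=
  add_pow_char_pow x y 2 k

lemma polarization_pow_two_pow_add_one (k : ℕ) (x y : K) :
    polarization (fun x : K => x ^ (2 ^ k + 1)) x y = x ^ 2 ^ k * y + x * y ^ 2 ^ k := by
  simp only [polarization, pow_succ _ (2 ^ k), add_pow_two_pow]
  linear_combination (x ^ 2 ^ k * x + y ^ 2 ^ k * y) * (CharTwo.two_eq_zero : (2 : K) = 0)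

lemma polarization_binomial (m i : ℕ) (x y : K) :
    polarization (binomial m i) x y =
      x ^ 2 ^ m * y + x * y ^ 2 ^ m + (x ^ 2 ^ i * y + x * y ^ 2 ^ i) := by
  rw [← polarization_pow_two_pow_add_one m, ← polarization_pow_two_pow_add_one i]
  simp only [polarization, binomial]
  ring

lemma polarization_component (F : K → K) (a x y : K) :
    polarization (component F a) x y = pairing a (polarization F x y) := by
  simp [polarization, component, pairing_add]

variable [Fintype K]

lemma pairing_pow_two_pow (a b : K) (k : ℕ) :
    pairing (a ^ 2 ^ k) (b ^ 2 ^ k) = pairing a b := by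
  induction k with
  | zero => simp
  | succ k ih =>
    rw [← ih, pow_succ 2 k, pow_mul, pow_mul]
    simp only [pairing, ← mul_pow]
    exact Algebra.trace_eq_of_algEquiv (FiniteField.frobeniusAlgEquiv (ZMod 2) K 2) _

/-- The radical criterion for a function whose polarization is biadditive. -/
lemma mem_nonbentSet_iff_of_quadratic (F : K → K)
    (hF : ∀ x y z, polarization F x (y + z) = polarization F x y + polarization F x z) (a : K) :
    a ∈ nonbentSet F ↔ ∃ x, x ≠ 0 ∧ ∀ u, pairing a (polarization F x u) = 0 := by
  have h := isBent_iff_of_quadratic (component F a) fun x y z => by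
    simp only [polarization_component, hF, pairing_add]
  simp only [polarization_component] at h
  rw [nonbentSet, Set.mem_ofPred_eq, h]
  constructor
  · rintro (rfl | h)
    · exact ⟨1, one_ne_zero, fun u => zero_pairing _⟩
    · push Not at h
      exact h
  · rintro ⟨x, hx, hu⟩
    right
    push Not
    exact ⟨x, hx, hu⟩

lemma eq_zero_of_forall_pairing_pow {a : K} {k : ℕ} (h : ∀ y : K, pairing a (y ^ 2 ^ k) = 0) :
    a = 0 := by
  by_contra ha
  obtain ⟨b, hb⟩ := exists_pairing_ne_zero ha
  obtain ⟨y, rfl⟩ := (iterateFrobeniusEquiv K 2 k).surjective b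
  exact hb (h y)

/-- The linearized polynomial in `x` whose nonzero zeros form the radical of the component of the
binomial at `a`. -/
def radicalPoly (m i : ℕ) (a x : K) : K :=
  (a ^ 2 ^ i + a ^ 2 ^ (m + i)) * x ^ 2 ^ (m + i) + a ^ 2 ^ i * x ^ 2 ^ (2 * i) + a * x

/-- The radical polynomial is adjoint to the polarization of the binomial, up to a power of the
Frobenius. -/
lemma pairing_polarization_binomial {m : ℕ} (hK : Fintype.card K = 2 ^ (2 * m)) (i : ℕ)
    (a x y : K) :
    pairing a (polarization (binomial m i) x y) =
      pairing (radicalPoly m i a x) (y ^ 2 ^ i) := by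
  have h1 : pairing a (x ^ 2 ^ m * y) = pairing (a ^ 2 ^ i * x ^ 2 ^ (m + i)) (y ^ 2 ^ i) := by
    rw [← pairing_pow_two_pow a _ i, mul_pow, pow_two_pow_two_pow, pairing, pairing, mul_assoc]
  have h2 : pairing a (x * y ^ 2 ^ m) =
      pairing (a ^ 2 ^ (m + i) * x ^ 2 ^ (m + i)) (y ^ 2 ^ i) := by
    rw [← pairing_pow_two_pow a _ (m + i), mul_pow, pow_two_pow_two_pow, ← add_assoc, ← two_mul,
      pow_two_pow_two_mul_add hK, pairing, pairing, mul_assoc]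
  have h3 : pairing a (x ^ 2 ^ i * y) = pairing (a ^ 2 ^ i * x ^ 2 ^ (2 * i)) (y ^ 2 ^ i) := by
    rw [← pairing_pow_two_pow a _ i, mul_pow, pow_two_pow_two_pow, ← two_mul, pairing, pairing,
      mul_assoc]
  have h4 : pairing a (x * y ^ 2 ^ i) = pairing (a * x) (y ^ 2 ^ i) := by
    rw [pairing, pairing, mul_assoc]
  rw [polarization_binomial, pairing_add, pairing_add, pairing_add, h1, h2, h3, h4, radicalPoly,
    add_mul, add_pairing, add_pairing, add_pairing]
  ring

theorem mem_nonbentSet_binomial {m : ℕ} (hK : Fintype.card K = 2 ^ (2 * m)) (i : ℕ) (a : K) :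
    a ∈ nonbentSet (binomial m i) ↔ ∃ x, x ≠ 0 ∧ radicalPoly m i a x = 0 := by
  rw [mem_nonbentSet_iff_of_quadratic]
  · refine exists_congr fun x => and_congr_right fun _ => ?_
    simp_rw [pairing_polarization_binomial hK]
    exact ⟨fun h => eq_zero_of_forall_pairing_pow h, fun h u => by rw [h, zero_pairing]⟩
  · intro x y z
    simp only [polarization_binomial, add_pow_two_pow]
    ring

/-- Every nonzero `x` lies in the radical of some nonzero component, because `x` is orthogonal to
itself for all of them. -/
lemma exists_radicalPoly_eq_zero {m : ℕ} (hK : Fintype.card K = 2 ^ (2 * m)) (i : ℕ) {x : K}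
    (hx : x ≠ 0) : ∃ a, a ≠ 0 ∧ radicalPoly m i a x = 0 := by
  let f : K →+ K := AddMonoidHom.mk' (fun a => radicalPoly m i a x) fun a b => by
    simp only [radicalPoly, add_pow_two_pow]
    ring
  have hself : polarization (binomial m i) x x = 0 := by
    rw [polarization_binomial]
    linear_combination (x ^ 2 ^ m * x + x ^ 2 ^ i * x) * (CharTwo.two_eq_zero : (2 : K) = 0)
  have hsurj : ¬ Function.Surjective f := by
    intro hs
    obtain ⟨v, hv⟩ := exists_pairing_ne_zero (pow_ne_zero (2 ^ i) hx)
    obtain ⟨a, rfl⟩ := hs v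
    rw [pairing_comm] at hv
    apply hv
    show pairing (radicalPoly m i a x) (x ^ 2 ^ i) = 0
    rw [← pairing_polarization_binomial hK, hself, pairing_zero]
  rw [← Finite.injective_iff_surjective, injective_iff_map_eq_zero] at hsurj
  push Not at hsurj
  obtain ⟨a, ha, hne⟩ := hsurj
  exact ⟨a, hne, ha⟩

lemma not_two_pow_add_one_dvd {m i : ℕ} (hi0 : 0 < i) (hi : i < m) :
    ¬ 2 ^ m + 1 ∣ 2 ^ (2 * i) - 1 := by
  intro h
  have hA : 1 < 2 ^ (2 * i) := Nat.one_lt_two_pow (by omega)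
  rcases le_or_gt m (2 * i) with hle | hlt
  · obtain ⟨j, hj⟩ := Nat.exists_eq_add_of_le hle
    have hjm : 2 ^ j < 2 ^ m := Nat.pow_lt_pow_right (by norm_num) (by omega)
    rw [hj, pow_add] at h
    have hpos : 0 < 2 ^ m * 2 ^ j := by positivity
    have h2 : 2 ^ m + 1 ∣ 2 ^ j + 1 := by
      have h3 : 2 ^ m + 1 ∣ (2 ^ m * 2 ^ j - 1) + (2 ^ j + 1) :=
        ⟨2 ^ j, by
          rw [add_mul, one_mul, add_comm (2 ^ j) 1, ← add_assoc, Nat.sub_add_cancel hpos]⟩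
      exact (Nat.dvd_add_right h).1 h3
    have := Nat.le_of_dvd (Nat.succ_pos _) h2
    omega
  · have := Nat.le_of_dvd (by omega) h
    have : 2 ^ (2 * i) < 2 ^ m := Nat.pow_lt_pow_right (by norm_num) hlt
    omega

/-- For `0 < i < m` some nonbent component is indexed outside the subfield with `2 ^ m` elements.
Otherwise every `x` would satisfy `x ^ (2 ^ (2 * i + m) + 1) = x ^ (2 ^ (2 * i) + 2 ^ m)`, which
fails for a generator of the multiplicative group. -/
theorem exists_mem_nonbentSet_binomial_pow_ne {m i : ℕ} (hK : Fintype.card K = 2 ^ (2 * m))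
    (hi0 : 0 < i) (hi : i < m) : ∃ a ∈ nonbentSet (binomial (K := K) m i), a ^ 2 ^ m ≠ a := by
  by_contra! hall
  have hid : ∀ x : K, x ≠ 0 → x ^ 2 ^ (2 * i + m) * x = x ^ 2 ^ (2 * i) * x ^ 2 ^ m := by
    intro x hx
    obtain ⟨a, ha, hrad⟩ := exists_radicalPoly_eq_zero hK i hx
    have ham := hall a ((mem_nonbentSet_binomial hK i a).2 ⟨x, hx, hrad⟩)
    rw [radicalPoly, ← pow_two_pow_two_pow a m i, ham, CharTwo.add_self_eq_zero, zero_mul,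
      zero_add, CharTwo.add_eq_zero] at hrad
    have hrad' := congrArg (· ^ 2 ^ m) hrad
    simp only [mul_pow, pow_two_pow_two_pow] at hrad'
    rw [add_comm i m, ← pow_two_pow_two_pow, ham] at hrad'
    apply mul_left_cancel₀ (mul_ne_zero (pow_ne_zero (2 ^ i) ha) ha)
    linear_combination (a * x) * hrad' - (a * x ^ 2 ^ m) * hrad
  have hm1 : 1 < 2 ^ m := Nat.one_lt_two_pow (by omega)
  have hA1 : 1 < 2 ^ (2 * i) := Nat.one_lt_two_pow (by omega)
  obtain ⟨M, hM⟩ : ∃ M, 2 ^ m = M + 1 := ⟨2 ^ m - 1, by omega⟩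
  obtain ⟨A, hA⟩ : ∃ A, 2 ^ (2 * i) = A + 1 := ⟨2 ^ (2 * i) - 1, by omega⟩
  have hMpos : 0 < M := by omega
  obtain ⟨ζ, hζ⟩ := exists_isPrimitiveRoot (K := K) (n := M * (M + 2)) (d := M * (M + 2))
    (by rw [hK, mul_comm 2 m, pow_mul, hM]; ring) dvd_rfl (by positivity)
  have hζ0 : ζ ≠ 0 := hζ.ne_zero (by positivity)
  have h1 : ζ ^ (M * A) = 1 := by
    have h := hid ζ hζ0
    rw [pow_add, hM, hA] at h
    apply mul_right_cancel₀ (mul_ne_zero (pow_ne_zero (A + 1) hζ0) (pow_ne_zero (M + 1) hζ0))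
    rw [one_mul]
    exact Eq.trans (by ring) h
  have h2 := Nat.dvd_of_mul_dvd_mul_left hMpos (hζ.dvd_of_pow_eq_one _ h1)
  refine not_two_pow_add_one_dvd hi0 hi ?_
  rw [hM, hA]
  exact h2

end Field

/-! ### The binomial with `0 < i < m` misses the maximum -/

section Field

variable {K : Type*} [Field K] [Algebra (ZMod 2) K] [Fintype K]

/-- The relative trace onto the subfield with `2 ^ m` elements is surjective. -/
lemma exists_add_pow_eq {m : ℕ} (hK : Fintype.card K = 2 ^ (2 * m)) (hm : 0 < m) {f : K}
    (hf : f ^ 2 ^ m = f) : ∃ y, y + y ^ 2 ^ m = f := by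
  obtain ⟨z, hz⟩ : ∃ z : K, z ^ 2 ^ m ≠ z := by
    by_contra! hall
    have h1 := ncard_setOf_pow_two_pow_eq_le (K := K) hm
    rw [Set.eq_univ_of_forall (s := {x : K | x ^ 2 ^ m = x}) hall, Set.ncard_univ,
      Nat.card_eq_fintype_card, hK] at h1
    have : 2 ^ m < 2 ^ (2 * m) := Nat.pow_lt_pow_right (by norm_num) (by omega)
    omega
  have hw : z + z ^ 2 ^ m ≠ 0 := fun h => hz (CharTwo.add_eq_zero.1 h).symm
  have hfix : (z + z ^ 2 ^ m) ^ 2 ^ m = z + z ^ 2 ^ m := by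
    rw [add_pow_two_pow, pow_two_pow_two_pow, ← two_mul]
    have := pow_two_pow_two_mul_add hK z 0
    simp only [add_zero, pow_zero, pow_one] at this
    rw [this, add_comm]
  refine ⟨z * (f / (z + z ^ 2 ^ m)), ?_⟩
  rw [mul_pow, div_pow, hf, hfix, ← add_mul, mul_div_cancel₀ _ hw]

/-- The powers `b ^ (2 ^ i + 1)` of elements of the subfield with `2 ^ m` elements index nonbent
components, with `b⁻¹` in the radical. -/
lemma pow_two_pow_add_one_mem_nonbentSet {m i : ℕ} (hK : Fintype.card K = 2 ^ (2 * m)) {b : K}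
    (hb : b ^ 2 ^ m = b) : b ^ (2 ^ i + 1) ∈ nonbentSet (binomial (K := K) m i) := by
  by_cases h0 : b = 0
  · rw [h0, zero_pow (Nat.succ_ne_zero _)]
    exact zero_mem_nonbentSet _
  · rw [mem_nonbentSet_binomial hK]
    refine ⟨b⁻¹, inv_ne_zero h0, ?_⟩
    have ha : (b ^ (2 ^ i + 1)) ^ 2 ^ m = b ^ (2 ^ i + 1) := by
      rw [← pow_mul, mul_comm, pow_mul, hb]
    have h1 : (b ^ (2 ^ i + 1)) ^ 2 ^ i = b ^ 2 ^ (2 * i) * b ^ 2 ^ i := by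
      rw [pow_succ b, mul_pow, pow_two_pow_two_pow, two_mul]
    rw [radicalPoly, ← pow_two_pow_two_pow _ m i, ha, CharTwo.add_self_eq_zero, zero_mul,
      zero_add, h1, pow_succ, inv_pow]
    field_simp
    rw [CharTwo.add_self_eq_zero, mul_zero]

lemma add_mem_nonbentSet (F : K → K) {m : ℕ} (hK : Fintype.card K = 2 ^ (2 * m)) (hm : 0 < m)
    (hN : (nonbentSet F).ncard = 2 ^ m) {a b : K} (ha : a ∈ nonbentSet F)
    (hb : b ∈ nonbentSet F) : a + b ∈ nonbentSet F :=
  mem_nonbentSet_of_forall_orthogonal F hK hm hN fun t ht => by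
    rw [pairing_add, ht a ha, ht b hb, add_zero]

/-- An element orthogonal to all `b ^ (2 ^ i + 1)` with `b` in the subfield with `2 ^ m` elements
lies in that subfield, unless `m = 2 * i`: polarizing, its relative trace `s` satisfies
`s ^ 2 ^ i * b ^ 2 ^ (2 * i) = s * b` for all `b`. -/
lemma pow_eq_self_of_forall_orthogonal {m i : ℕ} (hK : Fintype.card K = 2 ^ (2 * m))
    (hi0 : 0 < i) (hi : i < m) (hmi : m ≠ 2 * i) {t : K}
    (ht : ∀ b : K, b ^ 2 ^ m = b → pairing t (b ^ (2 ^ i + 1)) = 0) : t ^ 2 ^ m = t := by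
  have hpow : ∀ y : K, y ^ 2 ^ (2 * m) = y := fun y => by
    simpa using pow_two_pow_two_mul_add hK y 0
  have hpolar : ∀ b c : K, b ^ 2 ^ m = b → c ^ 2 ^ m = c →
      pairing t (b ^ 2 ^ i * c + b * c ^ 2 ^ i) = 0 := by
    intro b c hb hc
    rw [← polarization_pow_two_pow_add_one]
    simp only [polarization, pairing_add]
    rw [ht b hb, ht c hc, ht (b + c) (by rw [add_pow_two_pow, hb, hc]),
      zero_pow (Nat.succ_ne_zero _)]
    simp
  have hs : ∀ b : K, b ^ 2 ^ m = b →
      (t + t ^ 2 ^ m) ^ 2 ^ i * b ^ 2 ^ (2 * i) + (t + t ^ 2 ^ m) * b = 0 := by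
    intro b hb
    refine eq_zero_of_forall_pairing_pow (k := i) fun y => ?_
    have h1 : pairing t (b ^ 2 ^ i * y) =
        pairing (t ^ 2 ^ i * b ^ 2 ^ (2 * i)) (y ^ 2 ^ i) := by
      rw [← pairing_pow_two_pow t _ i, mul_pow, pow_two_pow_two_pow, ← two_mul, pairing, pairing,
        mul_assoc]
    have h2 : pairing t (b ^ 2 ^ i * y ^ 2 ^ m) =
        pairing (t ^ 2 ^ (m + i) * b ^ 2 ^ (2 * i)) (y ^ 2 ^ i) := by
      rw [← pairing_pow_two_pow t _ (m + i), mul_pow, pow_two_pow_two_pow, pow_two_pow_two_pow,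
        show m + (m + i) = 2 * m + i by ring, pow_two_pow_two_mul_add hK,
        show i + (m + i) = m + 2 * i by ring,
        ← pow_two_pow_two_pow b m, hb, pairing, pairing, mul_assoc]
    have h3 : pairing t (b * y ^ 2 ^ i) = pairing (t * b) (y ^ 2 ^ i) := by
      rw [pairing, pairing, mul_assoc]
    have h4 : pairing t (b * (y ^ 2 ^ m) ^ 2 ^ i) = pairing (t ^ 2 ^ m * b) (y ^ 2 ^ i) := by
      rw [← pairing_pow_two_pow t _ m, mul_pow, pow_two_pow_two_pow, pow_two_pow_two_pow, hb,
        show m + (i + m) = 2 * m + i by ring, pow_two_pow_two_mul_add hK, pairing, pairing,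
        mul_assoc]
    have h := hpolar b (y + y ^ 2 ^ m) hb
      (by rw [add_pow_two_pow, pow_two_pow_two_pow, ← two_mul, hpow, add_comm])
    rw [add_pow_two_pow, mul_add, mul_add, pairing_add, pairing_add, pairing_add, h1, h2, h3,
      h4] at h
    rw [← h, add_pow_two_pow, pow_two_pow_two_pow]
    simp only [add_mul, add_pairing]
  by_contra hne
  have hs0 : t + t ^ 2 ^ m ≠ 0 := fun h => hne (CharTwo.add_eq_zero.1 h).symm
  have hs1 : (t + t ^ 2 ^ m) ^ 2 ^ i = t + t ^ 2 ^ m := by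
    have h := hs 1 (one_pow _)
    rw [one_pow, mul_one, mul_one] at h
    exact CharTwo.add_eq_zero.1 h
  have hb : ∀ b : K, b ^ 2 ^ m = b → b ^ 2 ^ (2 * i) = b := fun b hb => by
    have h := CharTwo.add_eq_zero.1 (hs b hb)
    rw [hs1] at h
    exact mul_left_cancel₀ hs0 h
  -- a proper power of the Frobenius cannot fix the whole subfield with `2 ^ m` elements
  have hcount : ∀ k, 0 < k → k < m → ¬ ∀ b : K, b ^ 2 ^ m = b → b ^ 2 ^ k = b := by
    intro k hk0 hkm hall
    have h1 := Set.ncard_le_ncard (s := {x : K | x ^ 2 ^ m = x}) (t := {x : K | x ^ 2 ^ k = x})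
      hall (Set.toFinite _)
    rw [ncard_setOf_pow_two_pow_eq hK (by omega) (by omega) (dvd_mul_left m 2)] at h1
    have h2 := ncard_setOf_pow_two_pow_eq_le (K := K) hk0
    have : 2 ^ k < 2 ^ m := Nat.pow_lt_pow_right (by norm_num) hkm
    omega
  rcases lt_or_gt_of_ne hmi with hlt | hlt
  · refine hcount (2 * i - m) (by omega) (by omega) fun b hbm => ?_
    have h := hb b hbm
    rwa [show 2 * i = m + (2 * i - m) by omega, ← pow_two_pow_two_pow, hbm] at h
  · exact hcount (2 * i) (by omega) hlt hb

/-- If `m = 2 * i` and the set `N` of nonbent components has `2 ^ m` elements, then `N` lies in the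
subfield with `2 ^ m` elements. With `q = 2 ^ i`, the set `N` is a plane over the field with `q`
elements on which the `q`-Frobenius `φ` acts unipotently, so that `(φ - 1) ^ 2 = 0` there. -/
lemma pow_eq_self_of_mem_nonbentSet {i : ℕ} (hK : Fintype.card K = 2 ^ (2 * (2 * i)))
    (hi0 : 0 < i) (hN : (nonbentSet (binomial (K := K) (2 * i) i)).ncard = 2 ^ (2 * i))
    {a : K} (ha : a ∈ nonbentSet (binomial (K := K) (2 * i) i)) : a ^ 2 ^ (2 * i) = a := by
  set N := nonbentSet (binomial (K := K) (2 * i) i) with hNdef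
  have hadd : ∀ {a b : K}, a ∈ N → b ∈ N → a + b ∈ N :=
    add_mem_nonbentSet _ hK (by omega) hN
  have hsmul : ∀ {c a : K}, c ^ 2 ^ i = c → a ∈ N → c * a ∈ N := by
    intro c a hc ha
    rw [hNdef, mem_nonbentSet_binomial hK] at ha ⊢
    obtain ⟨x, hx, h⟩ := ha
    refine ⟨x, hx, ?_⟩
    have hc3 : c ^ 2 ^ (2 * i + i) = c := by
      rw [two_mul, ← pow_two_pow_two_pow, ← pow_two_pow_two_pow, hc, hc, hc]
    rw [radicalPoly] at h ⊢
    rw [mul_pow, mul_pow, hc3, hc]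
    linear_combination c * h
  have hfrob : ∀ {a : K}, a ∈ N → a ^ 2 ^ i ∈ N := by
    intro a ha
    rw [hNdef, mem_nonbentSet_binomial hK] at ha ⊢
    obtain ⟨x, hx, h⟩ := ha
    refine ⟨x ^ 2 ^ i, pow_ne_zero _ hx, ?_⟩
    have h2 := congrArg (· ^ 2 ^ i) h
    simp only [radicalPoly, add_pow_two_pow, mul_pow, pow_two_pow_two_pow,
      zero_pow (Nat.two_pow_pos i).ne'] at h2
    rw [← h2]
    simp only [radicalPoly, pow_two_pow_two_pow, add_comm i]
  let ψ : K →+ K := AddMonoidHom.mk' (fun v => v ^ 2 ^ i + v) fun u v => by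
    rw [add_pow_two_pow]; ring
  have hψ : ∀ v, ψ v = v ^ 2 ^ i + v := fun v => rfl
  have hψN : ∀ {v}, v ∈ N → ψ v ∈ N := fun hv => hadd (hfrob hv) hv
  have hψmul : ∀ c v, c ^ 2 ^ i = c → ψ (c * v) = c * ψ v := fun c v hc => by
    rw [hψ, hψ, mul_pow, hc, mul_add]
  have hψψ : ∀ v, ψ (ψ v) = v ^ 2 ^ (2 * i) + v := fun v => by
    simp only [hψ, add_pow_two_pow, pow_two_pow_two_pow, ← two_mul]
    linear_combination (v ^ 2 ^ i) * (CharTwo.two_eq_zero : (2 : K) = 0)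
  have hψ4 : ∀ v, ψ (ψ (ψ (ψ v))) = 0 := fun v => by
    rw [hψψ (ψ (ψ v)), hψψ v, add_pow_two_pow, pow_two_pow_two_pow, ← two_mul]
    have : v ^ 2 ^ (2 * (2 * i)) = v := by simpa using pow_two_pow_two_mul_add hK v 0
    rw [this]
    linear_combination (v + v ^ 2 ^ (2 * i)) * (CharTwo.two_eq_zero : (2 : K) = 0)
  -- a chain `v, ψ v, ψ ψ v` of nonzero elements would span `q ^ 3` elements of `N`
  have hchain : ∀ v ∈ N, ψ (ψ (ψ v)) = 0 → ψ (ψ v) = 0 := by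
    intro v hv h3
    by_contra h2
    let S : Set K := {x : K | x ^ 2 ^ i = x}
    have hS : Nat.card S = 2 ^ i :=
      ncard_setOf_pow_two_pow_eq hK (by omega) hi0 ⟨4, by ring⟩
    let g : S × S × S → N := fun p => ⟨p.1 * v + p.2.1 * ψ v + p.2.2 * ψ (ψ v),
      hadd (hadd (hsmul p.1.2 hv) (hsmul p.2.1.2 (hψN hv))) (hsmul p.2.2.2 (hψN (hψN hv)))⟩
    have hg : Function.Injective g := by
      rintro ⟨⟨x, hx⟩, ⟨y, hy⟩, ⟨z, hz⟩⟩ ⟨⟨x', hx'⟩, ⟨y', hy'⟩, ⟨z', hz'⟩⟩ h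
      have e0 : x * v + y * ψ v + z * ψ (ψ v) = x' * v + y' * ψ v + z' * ψ (ψ v) :=
        congrArg Subtype.val h
      have hlin : ∀ c ∈ S, ∀ w, ψ (c * w) = c * ψ w := fun c hc w => hψmul c w hc
      have e1 := congrArg ψ e0
      rw [map_add, map_add, map_add, map_add, hlin x hx, hlin y hy, hlin z hz, hlin x' hx',
        hlin y' hy', hlin z' hz', h3, mul_zero, mul_zero, add_zero, add_zero] at e1
      have e2 := congrArg ψ e1
      rw [map_add, map_add, hlin x hx, hlin y hy, hlin x' hx',
        hlin y' hy', h3, mul_zero, mul_zero, add_zero, add_zero] at e2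
      obtain rfl := mul_right_cancel₀ h2 e2
      obtain rfl := mul_right_cancel₀ h2 (add_left_cancel e1)
      obtain rfl := mul_right_cancel₀ h2 (add_left_cancel e0)
      rfl
    have hle := Nat.card_le_card_of_injective g hg
    rw [Nat.card_prod, Nat.card_prod, hS, Nat.card_coe_set_eq, hN, ← pow_add, ← pow_add] at hle
    have := (Nat.pow_le_pow_iff_right (by norm_num : 1 < 2)).1 hle
    omega
  have h2 : ψ (ψ a) = 0 := hchain a ha (hchain (ψ a) (hψN ha) (hψ4 a))
  rw [hψψ] at h2
  exact CharTwo.add_eq_zero.1 h2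

theorem ncard_nonbentSet_binomial_ne {m i : ℕ} (hK : Fintype.card K = 2 ^ (2 * m))
    (hi0 : 0 < i) (hi : i < m) : (nonbentSet (binomial (K := K) m i)).ncard ≠ 2 ^ m := by
  intro hN
  obtain ⟨a, haN, ham⟩ := exists_mem_nonbentSet_binomial_pow_ne hK hi0 hi
  by_cases hmi : m = 2 * i
  · subst hmi
    exact ham (pow_eq_self_of_mem_nonbentSet hK hi0 hN haN)
  · have hsub : {x : K | x ^ 2 ^ m = x} ⊆ nonbentSet (binomial m i) := by
      intro f hf
      refine mem_nonbentSet_of_forall_orthogonal _ hK (by omega) hN fun t ht => ?_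
      have htm : t ^ 2 ^ m = t := pow_eq_self_of_forall_orthogonal hK hi0 hi hmi fun b hb =>
        ht _ (pow_two_pow_add_one_mem_nonbentSet hK hb)
      obtain ⟨y, rfl⟩ := exists_add_pow_eq hK (by omega) hf
      rw [pairing_add, ← pairing_pow_two_pow t y m, htm, zmod_two_add_self]
    have heq := Set.eq_of_subset_of_ncard_le hsub
      (by rw [hN, ncard_setOf_pow_two_pow_eq hK (by omega) (by omega) (dvd_mul_left m 2)])
      (Set.toFinite _)
    rw [← heq] at haN
    exact ham haN

/-! ### The binomial with `i = 0` and affine equivalence -/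

/-- For a function with the polarization of `x ^ (2 ^ m + 1)`, the nonbent components are indexed
by the subfield with `2 ^ m` elements. -/
lemma ncard_nonbentSet_of_polarization_eq {m : ℕ} (hK : Fintype.card K = 2 ^ (2 * m))
    (hm : 0 < m) (F : K → K)
    (hF : ∀ x y, polarization F x y = x ^ 2 ^ m * y + x * y ^ 2 ^ m) :
    (nonbentSet F).ncard = 2 ^ m := by
  rw [← ncard_setOf_pow_two_pow_eq hK (by omega) hm (dvd_mul_left m 2)]
  congr 1
  ext a
  have hadj : ∀ x u, pairing a (polarization F x u) =
      pairing ((a + a ^ 2 ^ m) * x ^ 2 ^ m) u := by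
    intro x u
    have h1 : pairing a (x ^ 2 ^ m * u) = pairing (a * x ^ 2 ^ m) u := by
      rw [pairing, pairing, mul_assoc]
    have h2 : pairing a (x * u ^ 2 ^ m) = pairing (a ^ 2 ^ m * x ^ 2 ^ m) u := by
      have := pow_two_pow_two_mul_add hK u 0
      rw [add_zero, pow_zero, pow_one] at this
      rw [← pairing_pow_two_pow a _ m, mul_pow, pow_two_pow_two_pow, ← two_mul, this, pairing,
        pairing, mul_assoc]
    rw [hF, pairing_add, h1, h2, add_mul, add_pairing]
  rw [mem_nonbentSet_iff_of_quadratic F (fun x y z => by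
    simp only [hF, add_pow_two_pow]; ring), Set.mem_ofPred_eq]
  simp_rw [hadj]
  constructor
  · rintro ⟨x, hx, h⟩
    have h0 : (a + a ^ 2 ^ m) * x ^ 2 ^ m = 0 := by
      by_contra hne
      obtain ⟨b, hb⟩ := exists_pairing_ne_zero hne
      exact hb (h b)
    rcases mul_eq_zero.1 h0 with h1 | h1
    · exact (CharTwo.add_eq_zero.1 h1).symm
    · exact absurd h1 (pow_ne_zero _ hx)
  · intro h
    refine ⟨1, one_ne_zero, fun u => ?_⟩
    rw [h, CharTwo.add_self_eq_zero, zero_mul, zero_pairing]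

/-- Bentness as a condition on all affine forms, a description that is visibly invariant under
affine substitutions. -/
lemma isBent_iff_forall_affine (f : K → ZMod 2) :
    IsBent f ↔ ∀ l : K →ᵃ[ZMod 2] ZMod 2,
      (∑ v, sgn (f v + l v)) ^ 2 = (Fintype.card K : ℤ) := by
  rw [isBent_iff_sq]
  constructor
  · intro h l
    obtain ⟨w, hw⟩ := exists_pairing_eq l.linear
    have hl : ∀ v, l v = pairing w v + l 0 := fun v => by
      rw [← hw]; exact congrFun l.decomp v
    have : ∑ v, sgn (f v + l v) = walsh f w * sgn (l 0) := by
      rw [walsh_eq, Finset.sum_mul]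
      refine Finset.sum_congr rfl fun v _ => ?_
      rw [hl v, ← add_assoc, sgn_add]
    rw [this, mul_pow, h, sq (sgn _), sgn_mul_self, mul_one]
  · intro h w
    exact h (pairingHom w).toAffineMap

lemma IsBent.comp_affine_add {f : K → ZMod 2} (hf : IsBent f) (B : K ≃ᵃ[ZMod 2] K)
    (l : K →ᵃ[ZMod 2] ZMod 2) : IsBent fun x => f (B x) + l x := by
  rw [isBent_iff_forall_affine] at hf ⊢
  intro l'
  rw [← hf ((l + l').comp B.symm.toAffineMap)]
  congr 1
  refine Fintype.sum_equiv B.toEquiv _ _ fun x => ?_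
  show _ = sgn (f (B x) + (l (B.symm (B x)) + l' (B.symm (B x))))
  rw [B.symm_apply_apply, add_assoc]

/-- A function affine equivalent to `G` has at least as many bent components as `G`. The component
of `A ∘ G ∘ B + C` at `a` is, up to affine changes, the component of `G` at the image of `a` under
the adjoint of the linear part of `A`. -/
lemma AffineEquivalent.ncard_nonbentSet_le {F G : K → K} (h : AffineEquivalent F G) :
    (nonbentSet F).ncard ≤ (nonbentSet G).ncard := by
  obtain ⟨A, B, C, hF⟩ := h
  have hex : ∀ a : K, ∃ a', ∀ y, pairing a (A.linear y) = pairing a' y := fun a =>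
    exists_pairing_eq ((pairingHom a).comp A.linear.toLinearMap)
  choose adj hadj using hex
  have hinj : Function.Injective adj := by
    intro a b hab
    by_contra hne
    obtain ⟨y, hy⟩ := exists_pairing_ne_zero (mt CharTwo.add_eq_zero.1 hne)
    obtain ⟨z, rfl⟩ := A.linear.surjective y
    apply hy
    rw [add_pairing, hadj, hadj, hab, zmod_two_add_self]
  refine Set.ncard_le_ncard_of_injOn adj ?_ hinj.injOn (Set.toFinite _)
  rintro a (rfl | ha)
  · left
    by_contra hne
    obtain ⟨y, hy⟩ := exists_pairing_ne_zero hne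
    rw [← hadj, zero_pairing] at hy
    exact hy rfl
  · right
    intro hb
    apply ha
    have hA : ∀ y, A y = A.linear y + A 0 := fun y => congrFun (A.toAffineMap).decomp y
    have := hb.comp_affine_add B
      ((pairingHom a).toAffineMap.comp C + AffineMap.const (ZMod 2) K (pairing a (A 0)))
    convert this using 1
    funext x
    simp only [component, hF, hA (G (B x)), pairing_add, hadj, AffineMap.coe_add, Pi.add_apply,
      AffineMap.comp_apply, LinearMap.coe_toAffineMap, pairingHom_apply, AffineMap.const_apply]
    ring

end Field

end BentFunctions

theorem mainTheorem1 {K : Type*} [Field K] [Fintype K] [Algebra (ZMod 2) K]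
    (m i : ℕ) (hK : Fintype.card K = 2 ^ (2 * m)) (hi : i < m) :
    (BentFunctions.numBentComponents (BentFunctions.binomial (K := K) m i)
        = 2 ^ (2 * m) - 2 ^ m ↔ i = 0) ∧
    (i = 0 ↔ BentFunctions.AffineEquivalent (BentFunctions.binomial (K := K) m i)
        (fun x : K => x ^ (2 ^ m + 1))) := by
  have hm : 0 < m := by omega
  have hcount := BentFunctions.numBentComponents_add_ncard (BentFunctions.binomial (K := K) m i)
  rw [hK] at hcount
  have hlt : 2 ^ m < 2 ^ (2 * m) := Nat.pow_lt_pow_right (by norm_num) (by omega)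
  have hzero : i = 0 → (BentFunctions.nonbentSet (BentFunctions.binomial (K := K) m i)).ncard =
      2 ^ m := by
    rintro rfl
    refine BentFunctions.ncard_nonbentSet_of_polarization_eq hK hm _ fun x y => ?_
    rw [BentFunctions.polarization_binomial, pow_zero, pow_one, pow_one,
      CharTwo.add_self_eq_zero, add_zero]
  have hpos : (BentFunctions.nonbentSet (BentFunctions.binomial (K := K) m i)).ncard = 2 ^ m →
      i = 0 := by
    intro h
    by_contra h0
    exact BentFunctions.ncard_nonbentSet_binomial_ne hK (by omega) hi h
  refine ⟨⟨fun h => hpos (by omega), fun h => ?_⟩, ⟨?_, fun h => hpos ?_⟩⟩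
  · have := hzero h
    omega
  · rintro rfl
    -- the extra term is the squaring map, which is additive
    let C : K →ₗ[ZMod 2] K := (FiniteField.frobeniusAlgEquiv (ZMod 2) K 2).toLinearMap
    refine ⟨AffineEquiv.refl _ _, AffineEquiv.refl _ _, C.toAffineMap, fun x => ?_⟩
    simp [BentFunctions.binomial, C]
  · refine le_antisymm (h.ncard_nonbentSet_le.trans_eq ?_)
      (BentFunctions.two_pow_le_ncard_nonbentSet _ hK hm)
    exact BentFunctions.ncard_nonbentSet_of_polarization_eq hK hm _
      (BentFunctions.polarization_pow_two_pow_add_one m)
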